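/- Let $K$ be a field (for instance $\mathbb C$), $N\ge 0$ an integer, $q\in K$ with $q\neq 0$ and $q^2\neq\pm1$, and $\lambda=q-q^{-1}$. Let $R$ be the standard Drinfeld–Jimbo matrix $$R^{i_1i_2}_{j_1j_2}=\delta^{i_1}_{j_1}\delta^{i_2}_{j_2}\bigl(1+(q-1)\delta^{i_1i_2}\bigr)+\lambda\,\delta^{i_1}_{j_2}\delta^{i_2}_{j_1}\Theta_{i_1i_2},\qquad \Theta_{ij}=1\text{ if }i>j,\ 0\text{ otherwise},$$ $\hat R=P_{12}R_{12}$ with $P_{12}$ the permutation matrix, $D^{-1}=\mathrm{diag}(q^{2(N-i)+1})_{i=1}^N$ and $Tr_q(X)=Tr(D^{-1}X)$. Let $\mathcal D$ be the associative unital $K$-algebra generated by the entries of the $N\times N$ matrices $T,T^{-1},L,L^{-1},\omega,J$ subject to $TT^{-1}=T^{-1}T=1$, $LL^{-1}=L^{-1}L=1$ and (with $X_1=X\otimes 1$, $X_2=1\otimes X$) $$\omega_2\hat R^{-1}\omega_2\hat R=-\hat R^{-1}\omega_2\hat R^{-1}\omega_2,\quad \omega_2\hat RL_2\hat R=\hat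 RL_2\hat R\omega_2,\quad \omega_2\hat RJ_2\hat R+\hat RJ_2\hat R\omega_2=-\hat R,$$ $$L_2\hat RL_2\hat R=\hat RL_2\hat RL_2,\quad J_2\hat RL_2\hat R=\hat RL_2\hat RJ_2,\quad J_2\hat RJ_2\hat R=-\hat R^{-1}J_2\hat RJ_2,$$ $$\hat RT_1T_2=T_1T_2\hat R,\quad \omega_1T_2=T_2\hat R^{-1}\omega_2\hat R^{-1},\quad J_1T_2=T_2\hat RJ_2\hat R,\quad L_1T_2=T_2\hat RL_2\hat R.$$ It is $\mathbb Z$-graded by $\deg T=\deg L=0$, $\deg\omega=1$, $\deg J=-1$. Put $W=1+\lambda\omega J$, $\overline W=1+\lambda J\omega$ and $$Q^*=\lambda^{-1}\bigl(Tr_q(JL^{-1}(1+\lambda J\omega))-Tr_q(J)\bigr).$$ Then $Q^*=Tr_q\bigl(J(L^{-1}-1)/\lambda+JL^{-1}J\omega\bigr)$, and $$(Q^*)^2=0,\qquad [Q^*,L]=0,\qquad [Q^*,T]=-q^{2N}\,TJ,\qquad [Q^*,J]_+=q^{2N}J^2,$$ $$[Q^*,\omega]_+=q^{2N}\Bigl(W\,\frac{1-L^{-1}}{\lambda}\,\overline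 W-\lambda\,\omega J^2\omega\Bigr).$$ Moreover $Q^*$ defines a differential $d^*$: there is a unique linear map $d^*:\mathcal D\to\mathcal D$ that has the following four properties: $d^*a=Q^*a-(-1)^n a\,Q^*$ for all $a$ homogeneous of degree $n$; $d^*\circ d^*=0$; $d^*(ab)=d^*(a)\,b+(-1)^n a\,d^*(b)$ for $a$ homogeneous of degree $n$ and all $b$; and $d^*$ lowers the degree by one. -/

import Mathlib

open scoped Kronecker

namespace QGL

section numeric

variable {K : Type*} [Field K] {N : ℕ}

/-- `λ = q - q⁻¹`. -/
def lam (q : K) : K := q - q⁻¹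

/-- The standard Drinfeld-Jimbo `R`-matrix of `GL_q(N)`; rows are indexed by the upper pair of
indices `(i₁, i₂)`, columns by the lower pair `(j₁, j₂)`. -/
def Rmat (q : K) : Matrix (Fin N × Fin N) (Fin N × Fin N) K :=
  Matrix.of fun i j =>
    (if i.1 = j.1 ∧ i.2 = j.2 then 1 + (q - 1) * (if i.1 = i.2 then 1 else 0) else 0)
      + lam q * (if i.1 = j.2 ∧ i.2 = j.1 then (if i.2 < i.1 then 1 else 0) else 0)

/-- The permutation matrix `P₁₂`. -/
def Pmat : Matrix (Fin N × Fin N) (Fin N × Fin N) K :=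
  Matrix.of fun i j => if i.1 = j.2 ∧ i.2 = j.1 then 1 else 0

/-- `R̂ = P₁₂ R₁₂`. -/
def Rhat (q : K) : Matrix (Fin N × Fin N) (Fin N × Fin N) K := Pmat * Rmat q

/-- The matrix `D⁻¹`, i.e. `diag(q^{2(N-i)+1})` for `i = 1, …, N`; here the index `i : Fin N`
starts at zero, so the `i`-th entry is `q^{2(N-(i+1))+1}`. -/
def Dinv (q : K) : Matrix (Fin N) (Fin N) K :=
  Matrix.diagonal fun i => q ^ (2 * (N - (i.val + 1)) + 1)

end numeric

section matrices

variable {K : Type*} [Field K] {N : ℕ} {A : Type*} [Ring A] [Algebra K A]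

/-- A numerical matrix, viewed as a matrix over a `K`-algebra `A`. -/
def num (A : Type*) [Ring A] [Algebra K A] {m : Type*} (M : Matrix m m K) : Matrix m m A :=
  M.map (algebraMap K A)

/-- `X₁ = X ⊗ 1`. -/
def in1 (X : Matrix (Fin N) (Fin N) A) : Matrix (Fin N × Fin N) (Fin N × Fin N) A := X ⊗ₖ 1

/-- `X₂ = 1 ⊗ X`. -/
def in2 (X : Matrix (Fin N) (Fin N) A) : Matrix (Fin N × Fin N) (Fin N × Fin N) A := 1 ⊗ₖ X

/-- The quantum trace `Tr_q(X) = Tr(D⁻¹ X)`. -/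
def trq (q : K) (X : Matrix (Fin N) (Fin N) A) : A := (num A (Dinv q) * X).trace

end matrices

/-- Generators: the entries of the matrices `T`, `T⁻¹`, `L`, `L⁻¹`, `ω`, `J`. -/
inductive Gen (N : ℕ) : Type
  | T (i j : Fin N)
  | Tinv (i j : Fin N)
  | L (i j : Fin N)
  | Linv (i j : Fin N)
  | om (i j : Fin N)
  | J (i j : Fin N)

/-- The degree: `T` and `L` have degree `0`, the forms `ω` degree `1`, the inner derivations `J`
degree `-1`. -/
def Gen.deg {N : ℕ} : Gen N → ℤ
  | .T _ _ => 0
  | .Tinv _ _ => 0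
  | .L _ _ => 0
  | .Linv _ _ => 0
  | .om _ _ => 1
  | .J _ _ => -1

section free

variable (K : Type*) [Field K] (N : ℕ)

def freeT : Matrix (Fin N) (Fin N) (FreeAlgebra K (Gen N)) :=
  Matrix.of fun i j => FreeAlgebra.ι K (Gen.T i j)

def freeTinv : Matrix (Fin N) (Fin N) (FreeAlgebra K (Gen N)) :=
  Matrix.of fun i j => FreeAlgebra.ι K (Gen.Tinv i j)

def freeL : Matrix (Fin N) (Fin N) (FreeAlgebra K (Gen N)) :=
  Matrix.of fun i j => FreeAlgebra.ι K (Gen.L i j)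

def freeLinv : Matrix (Fin N) (Fin N) (FreeAlgebra K (Gen N)) :=
  Matrix.of fun i j => FreeAlgebra.ι K (Gen.Linv i j)

def freeOm : Matrix (Fin N) (Fin N) (FreeAlgebra K (Gen N)) :=
  Matrix.of fun i j => FreeAlgebra.ι K (Gen.om i j)

def freeJ : Matrix (Fin N) (Fin N) (FreeAlgebra K (Gen N)) :=
  Matrix.of fun i j => FreeAlgebra.ι K (Gen.J i j)

/-- `R̂` as a matrix over the free algebra. -/
def freeR (q : K) : Matrix (Fin N × Fin N) (Fin N × Fin N) (FreeAlgebra K (Gen N)) :=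
  num (FreeAlgebra K (Gen N)) (Rhat q)

/-- `R̂⁻¹` as a matrix over the free algebra. -/
noncomputable def freeRinv (q : K) :
    Matrix (Fin N × Fin N) (Fin N × Fin N) (FreeAlgebra K (Gen N)) :=
  num (FreeAlgebra K (Gen N)) (Rhat q)⁻¹

end free

/-- The defining relations of the differential algebra over `GL_q(N)` (forms `ω`, inner
derivations `J`, vector fields `L`, functions `T`), entry by entry. -/
inductive Rel {K : Type*} [Field K] (N : ℕ) (q : K) :
    FreeAlgebra K (Gen N) → FreeAlgebra K (Gen N) → Prop
  /-- `ω₂ R̂⁻¹ ω₂ R̂ = - R̂⁻¹ ω₂ R̂⁻¹ ω₂` -/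
  | om_om (a b : Fin N × Fin N) : Rel N q
      ((in2 (freeOm K N) * freeRinv K N q * in2 (freeOm K N) * freeR K N q) a b)
      ((-(freeRinv K N q * in2 (freeOm K N) * freeRinv K N q * in2 (freeOm K N))) a b)
  /-- `ω₂ R̂ L₂ R̂ = R̂ L₂ R̂ ω₂` -/
  | om_L (a b : Fin N × Fin N) : Rel N q
      ((in2 (freeOm K N) * freeR K N q * in2 (freeL K N) * freeR K N q) a b)
      ((freeR K N q * in2 (freeL K N) * freeR K N q * in2 (freeOm K N)) a b)
  /-- `ω₂ R̂ J₂ R̂ + R̂ J₂ R̂ ω₂ = - R̂` -/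
  | om_J (a b : Fin N × Fin N) : Rel N q
      ((in2 (freeOm K N) * freeR K N q * in2 (freeJ K N) * freeR K N q
        + freeR K N q * in2 (freeJ K N) * freeR K N q * in2 (freeOm K N)) a b)
      ((-freeR K N q) a b)
  /-- `L₂ R̂ L₂ R̂ = R̂ L₂ R̂ L₂` -/
  | L_L (a b : Fin N × Fin N) : Rel N q
      ((in2 (freeL K N) * freeR K N q * in2 (freeL K N) * freeR K N q) a b)
      ((freeR K N q * in2 (freeL K N) * freeR K N q * in2 (freeL K N)) a b)
  /-- `J₂ R̂ L₂ R̂ = R̂ L₂ R̂ J₂` -/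
  | J_L (a b : Fin N × Fin N) : Rel N q
      ((in2 (freeJ K N) * freeR K N q * in2 (freeL K N) * freeR K N q) a b)
      ((freeR K N q * in2 (freeL K N) * freeR K N q * in2 (freeJ K N)) a b)
  /-- `J₂ R̂ J₂ R̂ = - R̂⁻¹ J₂ R̂ J₂` -/
  | J_J (a b : Fin N × Fin N) : Rel N q
      ((in2 (freeJ K N) * freeR K N q * in2 (freeJ K N) * freeR K N q) a b)
      ((-(freeRinv K N q * in2 (freeJ K N) * freeR K N q * in2 (freeJ K N))) a b)
  /-- `R̂ T₁ T₂ = T₁ T₂ R̂` -/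
  | T_T (a b : Fin N × Fin N) : Rel N q
      ((freeR K N q * in1 (freeT K N) * in2 (freeT K N)) a b)
      ((in1 (freeT K N) * in2 (freeT K N) * freeR K N q) a b)
  /-- `ω₁ T₂ = T₂ R̂⁻¹ ω₂ R̂⁻¹` -/
  | om_T (a b : Fin N × Fin N) : Rel N q
      ((in1 (freeOm K N) * in2 (freeT K N)) a b)
      ((in2 (freeT K N) * freeRinv K N q * in2 (freeOm K N) * freeRinv K N q) a b)
  /-- `J₁ T₂ = T₂ R̂ J₂ R̂` -/
  | J_T (a b : Fin N × Fin N) : Rel N q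
      ((in1 (freeJ K N) * in2 (freeT K N)) a b)
      ((in2 (freeT K N) * freeR K N q * in2 (freeJ K N) * freeR K N q) a b)
  /-- `L₁ T₂ = T₂ R̂ L₂ R̂` -/
  | L_T (a b : Fin N × Fin N) : Rel N q
      ((in1 (freeL K N) * in2 (freeT K N)) a b)
      ((in2 (freeT K N) * freeR K N q * in2 (freeL K N) * freeR K N q) a b)
  /-- `T T⁻¹ = 1` -/
  | T_Tinv (i j : Fin N) : Rel N q
      ((freeT K N * freeTinv K N) i j) ((1 : Matrix (Fin N) (Fin N) (FreeAlgebra K (Gen N))) i j)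
  /-- `T⁻¹ T = 1` -/
  | Tinv_T (i j : Fin N) : Rel N q
      ((freeTinv K N * freeT K N) i j) ((1 : Matrix (Fin N) (Fin N) (FreeAlgebra K (Gen N))) i j)
  /-- `L L⁻¹ = 1` -/
  | L_Linv (i j : Fin N) : Rel N q
      ((freeL K N * freeLinv K N) i j) ((1 : Matrix (Fin N) (Fin N) (FreeAlgebra K (Gen N))) i j)
  /-- `L⁻¹ L = 1` -/
  | Linv_L (i j : Fin N) : Rel N q
      ((freeLinv K N * freeL K N) i j) ((1 : Matrix (Fin N) (Fin N) (FreeAlgebra K (Gen N))) i j)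

/-- The differential algebra over `GL_q(N)`: the `K`-algebra with the above generators and
relations. -/
abbrev DiffAlg {K : Type*} [Field K] (N : ℕ) (q : K) : Type _ := RingQuot (Rel N q)

section alg

variable {K : Type*} [Field K] (N : ℕ) (q : K)

/-- The class of a generator in the differential algebra. -/
noncomputable def gen (g : Gen N) : DiffAlg N q :=
  RingQuot.mkAlgHom K (Rel N q) (FreeAlgebra.ι K g)

noncomputable def T : Matrix (Fin N) (Fin N) (DiffAlg N q) :=
  Matrix.of fun i j => gen N q (Gen.T i j)

noncomputable def L : Matrix (Fin N) (Fin N) (DiffAlg N q) :=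
  Matrix.of fun i j => gen N q (Gen.L i j)

noncomputable def Linv : Matrix (Fin N) (Fin N) (DiffAlg N q) :=
  Matrix.of fun i j => gen N q (Gen.Linv i j)

noncomputable def om : Matrix (Fin N) (Fin N) (DiffAlg N q) :=
  Matrix.of fun i j => gen N q (Gen.om i j)

noncomputable def J : Matrix (Fin N) (Fin N) (DiffAlg N q) :=
  Matrix.of fun i j => gen N q (Gen.J i j)

/-- `W = 1 + λ ω J`. -/
noncomputable def W : Matrix (Fin N) (Fin N) (DiffAlg N q) := 1 + lam q • (om N q * J N q)

/-- `W̄ = 1 + λ J ω`. -/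
noncomputable def Wbar : Matrix (Fin N) (Fin N) (DiffAlg N q) := 1 + lam q • (J N q * om N q)

/-- `Θ* = J L⁻¹ (1 + λ J ω)`. -/
noncomputable def ThetaStar : Matrix (Fin N) (Fin N) (DiffAlg N q) :=
  J N q * Linv N q * (1 + lam q • (J N q * om N q))

/-- The anti-BRST operator `Q* = λ⁻¹ (Tr_q(Θ*) - Tr_q(J))`. -/
noncomputable def Qstar : DiffAlg N q :=
  (lam q)⁻¹ • (trq q (ThetaStar N q) - trq q (J N q))

/-- The homogeneous elements of degree `n`: the span of the words in the generators of total
degree `n`. -/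
noncomputable def homog (n : ℤ) : Submodule K (DiffAlg N q) :=
  Submodule.span K {x | ∃ w : List (Gen N), (w.map Gen.deg).sum = n ∧ x = (w.map (gen N q)).prod}

end alg

end QGL

/-!
Write `R̂ = R̂⁻¹ + λ`. Over `R̂`, the matrices `W̄ = 1 + λ J ω` and `Θ* = J L⁻¹ W̄` satisfy exchange
relations of the same shape as the generators. The quantum trace over the first tensor factor sends
`R̂ X₂ R̂⁻¹` and `R̂⁻¹ X₂ R̂` to the scalar matrix `Tr_q(X)`, so it turns an exchange relation
between `X` and `Y` into the (anti)commutator of `Tr_q(X)` with the entries of `Y`; where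
`R̂ X₂ R̂` occurs instead, it leaves an additional term `λ q^{2N} X`.

Both `X = J` and `X = Θ*` satisfy `X₂ R̂ X₂ R̂ = -R̂⁻¹ X₂ R̂ X₂`. Cyclicity of the two-factor trace
under `R̂` then gives `(λ² + 4) Tr_q(X)² = 0`, where `λ² + 4 = (q + q⁻¹)² ≠ 0`. As `Tr_q(J)` and
`Tr_q(Θ*)` anticommute, `(Q*)² = 0`.

The relations are preserved by `ω ↦ s ω`, `J ↦ s⁻¹ J`; for `s = -1` this is the parity automorphism
`σ`, and `d* a = Q* a - σ(a) Q*` is a square-zero `σ`-derivation.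
-/

namespace QGL

section Hecke

variable {K M : Type*} [CommRing K] [Ring M] [Algebra K M] {R l : Mˣ} {c : K} {j w x : M}

theorem mul_conj_unit_inv (h : x * R * l * R = R * l * R * x) :
    x * ↑R⁻¹ * ↑l⁻¹ * ↑R⁻¹ = ↑R⁻¹ * ↑l⁻¹ * ↑R⁻¹ * x := by
  have hx : Commute x ↑(R * l * R) := by
    simpa only [Commute, SemiconjBy, Units.val_mul, mul_assoc] using h
  simpa only [Commute, SemiconjBy, mul_inv_rev, Units.val_mul, mul_assoc]
    using hx.units_inv_right

theorem semiconjBy_of_mul_conj (h : x * R * l * R = R * l * R * x) :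
    SemiconjBy (l : M) (R * x * ↑R⁻¹) (↑R⁻¹ * x * R) :=
  calc (l : M) * (R * x * ↑R⁻¹) = ↑R⁻¹ * (R * l * R * x) * ↑R⁻¹ := by
        simp only [mul_assoc, Units.inv_mul_cancel_left]
    _ = ↑R⁻¹ * (x * R * l * R) * ↑R⁻¹ := by rw [h]
    _ = ↑R⁻¹ * x * R * l := by simp only [mul_assoc, Units.mul_inv, mul_one]

theorem hecke_mul_self (hR : (R : M) = ↑R⁻¹ + c • 1) : (R : M) * R = 1 + c • (R : M) := by
  calc (R : M) * R = (↑R⁻¹ + c • 1) * R := by rw [← hR]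
    _ = 1 + c • (R : M) := by rw [add_mul, Units.inv_mul, smul_one_mul]

theorem om_mul_J (hwj : w * R * j * R + R * j * R * w = -R) :
    w * R * j = -1 - R * j * R * w * ↑R⁻¹ := by
  have h := congrArg (· * (↑R⁻¹ : M)) (eq_sub_of_add_eq hwj)
  simpa only [sub_mul, neg_mul, Units.mul_inv_cancel_right, Units.mul_inv] using h

theorem J_mul_Wbar (hR : (R : M) = ↑R⁻¹ + c • 1) (hjj : j * R * j * R = -(↑R⁻¹ * j * R * j))
    (hwj : w * R * j * R + R * j * R * w = -R) :
    j * R * (1 + c • (j * w)) * ↑R⁻¹ = R * (1 + c • (j * w)) * R * j := by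
  have hRjj : R * (j * R * j * R) = -(j * R * j) := by
    rw [hjj, mul_neg, ← mul_assoc, ← mul_assoc, Units.mul_inv_cancel_left]
  symm
  calc R * (1 + c • (j * w)) * R * j = R * R * j + c • (R * j * (w * R * j)) := by
        simp only [mul_add, add_mul, mul_one, mul_smul_comm, smul_mul_assoc, mul_assoc]
    _ = R * R * j - c • (R * j) - c • (R * (j * R * j * R) * w * ↑R⁻¹) := by
        rw [om_mul_J hwj]
        simp only [mul_sub, smul_sub, mul_neg, mul_one, smul_neg, mul_assoc]
        abel
    _ = j + c • (j * R * j * w * ↑R⁻¹) := by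
        rw [hRjj, hecke_mul_self hR]
        simp only [add_mul, one_mul, smul_mul_assoc, neg_mul, smul_neg]
        abel
    _ = j * R * (1 + c • (j * w)) * ↑R⁻¹ := by
        simp only [mul_add, add_mul, mul_one, mul_smul_comm, smul_mul_assoc, mul_assoc,
          Units.mul_inv]

theorem om_mul_Wbar (hR : (R : M) = ↑R⁻¹ + c • 1)
    (hww : w * ↑R⁻¹ * w * R = -(↑R⁻¹ * w * ↑R⁻¹ * w))
    (hwj : w * R * j * R + R * j * R * w = -R) :
    w * R * (1 + c • (j * w)) * R = R * (1 + c • (j * w)) * ↑R⁻¹ * w := by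
  calc w * R * (1 + c • (j * w)) * R = w * (R * R) + c • (w * R * j * w * R) := by
        simp only [mul_add, add_mul, mul_one, mul_smul_comm, smul_mul_assoc, mul_assoc]
    _ = w * (R * R) - c • (w * R) - c • (R * j * R * (w * ↑R⁻¹ * w * R)) := by
        rw [om_mul_J hwj]
        simp only [sub_mul, smul_sub, neg_mul, one_mul, smul_neg, mul_assoc]
        abel
    _ = w + c • (R * j * w * ↑R⁻¹ * w) := by
        rw [hww, hecke_mul_self hR]
        simp only [mul_add, mul_one, mul_smul_comm, mul_neg, smul_neg, mul_assoc,
          Units.mul_inv_cancel_left]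
        abel
    _ = R * (1 + c • (j * w)) * ↑R⁻¹ * w := by
        simp only [mul_add, add_mul, mul_one, mul_smul_comm, smul_mul_assoc, mul_assoc,
          Units.mul_inv_cancel_left]

theorem J_mul_Theta {V : M} (hjj : j * R * j * R = -(↑R⁻¹ * j * R * j))
    (hjl : j * R * l * R = R * l * R * j) (hjV : j * R * V * ↑R⁻¹ = R * V * R * j) :
    j * R * (j * ↑l⁻¹ * V) * ↑R⁻¹ = -(↑R⁻¹ * (j * ↑l⁻¹ * V) * R * j) :=
  calc j * R * (j * ↑l⁻¹ * V) * ↑R⁻¹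
      = (j * R * j * R) * ↑R⁻¹ * ↑l⁻¹ * ↑R⁻¹ * R * V * ↑R⁻¹ := by
        simp only [mul_assoc, Units.mul_inv_cancel_left, Units.inv_mul_cancel_left]
    _ = -(↑R⁻¹ * j * R * (j * ↑R⁻¹ * ↑l⁻¹ * ↑R⁻¹) * R * V * ↑R⁻¹) := by
        rw [hjj]; simp only [neg_mul, mul_assoc]
    _ = -(↑R⁻¹ * j * ↑l⁻¹ * ↑R⁻¹ * (j * R * V * ↑R⁻¹)) := by
        rw [mul_conj_unit_inv hjl]; simp only [mul_assoc, Units.mul_inv_cancel_left]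
    _ = -(↑R⁻¹ * (j * ↑l⁻¹ * V) * R * j) := by
        rw [hjV]; simp only [mul_assoc, Units.inv_mul_cancel_left]

theorem om_mul_Theta {V : M} (hwj : w * R * j * R + R * j * R * w = -R)
    (hwl : w * R * l * R = R * l * R * w) (hwV : w * R * V * R = R * V * ↑R⁻¹ * w) :
    w * R * (j * ↑l⁻¹ * V) * R = -(↑l⁻¹ * V * R) - R * (j * ↑l⁻¹ * V) * ↑R⁻¹ * w :=
  calc w * R * (j * ↑l⁻¹ * V) * R = w * R * j * ↑l⁻¹ * V * R := by simp only [mul_assoc]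
    _ = -(↑l⁻¹ * V * R) - R * j * R * (w * ↑R⁻¹ * ↑l⁻¹ * ↑R⁻¹) * R * V * R := by
        rw [om_mul_J hwj]
        simp only [sub_mul, neg_mul, one_mul, mul_assoc, Units.inv_mul_cancel_left]
    _ = -(↑l⁻¹ * V * R) - R * j * ↑l⁻¹ * ↑R⁻¹ * (w * R * V * R) := by
        rw [mul_conj_unit_inv hwl]; simp only [mul_assoc, Units.mul_inv_cancel_left]
    _ = -(↑l⁻¹ * V * R) - R * (j * ↑l⁻¹ * V) * ↑R⁻¹ * w := by
        rw [hwV]; simp only [mul_assoc, Units.inv_mul_cancel_left]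

theorem Theta_mul_L (hll : l * R * l * R = R * l * R * (l : M))
    (hjl : j * R * l * R = R * l * R * j) (hwl : w * R * l * R = R * l * R * w) :
    j * ↑l⁻¹ * (1 + c • (j * w)) * R * l * R = R * l * R * (j * ↑l⁻¹ * (1 + c • (j * w))) := by
  have commute_iff {x : M} : x * R * l * R = R * l * R * x ↔ Commute x ↑(R * l * R) := by
    simp only [Commute, SemiconjBy, Units.val_mul, mul_assoc]
  rw [commute_iff] at *
  exact (hjl.mul_left hll.units_inv_left).mul_left
    ((Commute.one_left _).add_left ((hjl.mul_left hwl).smul_left c))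

theorem Wbar_mul_Theta (hR : (R : M) = ↑R⁻¹ + c • 1) {Θ V : M} (hV : V = 1 + c • (j * w))
    (hΘ : Θ = j * ↑l⁻¹ * V) (hjΘ : j * R * Θ * ↑R⁻¹ = -(↑R⁻¹ * Θ * R * j))
    (hwΘ : w * R * Θ * R = -(↑l⁻¹ * V * R) - R * Θ * ↑R⁻¹ * w) :
    V * R * Θ * R = ↑R⁻¹ * Θ * R * V :=
  calc V * R * Θ * R = R * Θ * R + c • (j * (w * R * Θ * R)) := by
        rw [hV]; simp only [add_mul, one_mul, smul_mul_assoc, mul_assoc]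
    _ = (R - c • 1) * Θ * R - c • (j * R * Θ * ↑R⁻¹ * w) := by
        have hjlV : j * (↑l⁻¹ * V * R) = Θ * R := by rw [hΘ]; simp only [mul_assoc]
        rw [hwΘ, mul_sub, mul_neg, hjlV]
        simp only [sub_mul, smul_sub, smul_neg, one_mul, smul_mul_assoc, mul_assoc]
        abel
    _ = ↑R⁻¹ * Θ * R * V := by
        rw [hjΘ, sub_eq_of_eq_add hR, hV]
        simp only [mul_add, mul_one, neg_mul, smul_neg, mul_smul_comm, mul_assoc, sub_neg_eq_add]

theorem Theta_mul_Theta {Θ V : M} (hΘ : Θ = j * ↑l⁻¹ * V)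
    (hΘl : Θ * R * l * R = R * l * R * Θ)
    (hjΘ : j * R * Θ * ↑R⁻¹ = -(↑R⁻¹ * Θ * R * j))
    (hVΘ : V * R * Θ * R = ↑R⁻¹ * Θ * R * V) :
    Θ * R * Θ * R = -(↑R⁻¹ * Θ * R * Θ) := by
  have hlΘ := (semiconjBy_of_mul_conj hΘl).units_inv_symm_left
  calc Θ * R * Θ * R = j * ↑l⁻¹ * (V * R * Θ * R) := by
        nth_rewrite 1 [hΘ]; simp only [mul_assoc]
    _ = j * (↑l⁻¹ * (↑R⁻¹ * Θ * R)) * V := by rw [hVΘ]; simp only [mul_assoc]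
    _ = j * R * Θ * ↑R⁻¹ * ↑l⁻¹ * V := by rw [hlΘ.eq]; simp only [mul_assoc]
    _ = -(↑R⁻¹ * Θ * R * (j * ↑l⁻¹ * V)) := by rw [hjΘ]; simp only [neg_mul, mul_assoc]
    _ = -(↑R⁻¹ * Θ * R * Θ) := by rw [← hΘ]

theorem Theta_mul_T {t j₁ w₁ : M} {l₁ : Mˣ} (hj : j₁ * t = t * R * j * R)
    (hl : l₁ * t = t * R * l * R) (hw : w₁ * t = t * ↑R⁻¹ * w * ↑R⁻¹) :
    j₁ * ↑l₁⁻¹ * (1 + c • (j₁ * w₁)) * t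
      = t * R * (j * ↑l⁻¹ * (1 + c • (j * w))) * ↑R⁻¹ := by
  have semiconj_l : SemiconjBy t ↑(R * l * R)⁻¹ ↑l₁⁻¹ :=
    SemiconjBy.units_inv_right (by simp only [SemiconjBy, hl, Units.val_mul, mul_assoc])
  have semiconj_j : SemiconjBy t (R * j * R) j₁ := by simp only [SemiconjBy, hj, mul_assoc]
  have semiconj_w : SemiconjBy t (↑R⁻¹ * w * ↑R⁻¹) w₁ := by
    simp only [SemiconjBy, hw, mul_assoc]
  have h := (semiconj_j.mul_right semiconj_l).mul_right
    ((SemiconjBy.one_right t).add_right ((semiconj_j.mul_right semiconj_w).smul_right c))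
  rw [← h.eq]
  simp only [mul_inv_rev, Units.val_mul, mul_add, add_mul, mul_one, mul_smul_comm,
    smul_mul_assoc, mul_assoc, Units.mul_inv_cancel_left, Units.inv_mul_cancel_left]

theorem trace_inv_mul_eq_zero {P : Type*} [AddCommGroup P] [Module K P]
    (hR : (R : M) = ↑R⁻¹ + c • 1) (hc : IsUnit (c ^ 2 + 4)) (τ : M →ₗ[K] P)
    (hτ : ∀ x, τ (R * x) = τ (x * R)) (hx : R * x * R = -x) : τ (↑R⁻¹ * x) = 0 := by
  -- With `x`, also `y = R⁻¹ x` and `y = R⁻³ x` satisfy `R y R = -y`. Taking traces gives two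
  -- linear equations for `τ (R⁻¹ x)` and `τ x`, whose sum eliminates `τ x`.
  have inv_mul_inv_mul (y : M) : ↑R⁻¹ * (↑R⁻¹ * y) = y - c • (↑R⁻¹ * y) := by
    nth_rewrite 1 [eq_sub_of_add_eq hR.symm]
    rw [sub_mul, Units.mul_inv_cancel_left, smul_one_mul]
  have conj_inv_mul (y : M) (hy : R * y * R = -y) : R * (↑R⁻¹ * y) * R = -(↑R⁻¹ * y) := by
    nth_rewrite 2 [← neg_eq_iff_eq_neg.mpr hy]
    simp only [mul_neg, neg_neg, mul_assoc, Units.mul_inv_cancel_left, Units.inv_mul_cancel_left]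
  have trace_add (y : M) (hy : R * y * R = -y) : τ y + τ (R * (R * y)) = 0 := by
    rw [hτ, hy, map_neg, add_neg_cancel]
  have trace_inv_add := trace_add _ (conj_inv_mul x hx)
  have trace_inv_cube_add := trace_add _ (conj_inv_mul _ (conj_inv_mul _ (conj_inv_mul x hx)))
  have two_smul_add : (2 : K) • τ (↑R⁻¹ * x) + c • τ x = 0 := by
    rw [Units.mul_inv_cancel_left, hR, add_mul, smul_one_mul, map_add, map_smul] at trace_inv_add
    rw [← trace_inv_add]; module
  have sq_add_two_smul_sub : (c ^ 2 + 2) • τ (↑R⁻¹ * x) - c • τ x = 0 := by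
    rw [Units.mul_inv_cancel_left, Units.mul_inv_cancel_left] at trace_inv_cube_add
    simp only [inv_mul_inv_mul, mul_sub, mul_smul_comm, map_sub, map_smul] at trace_inv_cube_add
    rw [← trace_inv_cube_add]; module
  refine hc.smul_left_cancel.mp ?_
  linear_combination (norm := module) two_smul_add + sq_add_two_smul_sub

end Hecke

section Numeric

variable {K : Type*} [Field K] {N : ℕ} {q : K}

theorem lam_ne_zero (hq0 : q ≠ 0) (hq1 : q ^ 2 ≠ 1) : lam q ≠ 0 := by
  intro h
  refine hq1 ?_
  rw [sq]
  nth_rewrite 2 [sub_eq_zero.mp h]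
  exact mul_inv_cancel₀ hq0

theorem lam_sq_add_four_ne_zero (hq0 : q ≠ 0) (hq2 : q ^ 2 ≠ -1) : lam q ^ 2 + 4 ≠ 0 := by
  have h : lam q ^ 2 + 4 = (q⁻¹ * (q ^ 2 + 1)) ^ 2 := by
    simp only [lam]
    field_simp
    ring
  rw [h]
  exact pow_ne_zero _ (mul_ne_zero (inv_ne_zero hq0) fun h => hq2 (eq_neg_of_add_eq_zero_left h))

theorem mul_self_eq_one_add_lam_mul (hq0 : q ≠ 0) : q * q = 1 + lam q * q := by
  rw [lam, sub_mul, inv_mul_cancel₀ hq0]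
  ring

/-- The diagonal entries of `D⁻¹`. -/
def weight (q : K) (i : Fin N) : K := q ^ (2 * (N - (i + 1)) + 1)

theorem sum_weight_mul (hq0 : q ≠ 0) (b : Fin N) :
    ∑ a, weight q a * (if a = b then q else if a < b then lam q else 0) = q ^ (2 * N) := by
  induction N with
  | zero => exact b.elim0
  | succ N ih =>
    have weight_zero : weight q (0 : Fin (N + 1)) = q ^ (2 * N + 1) := by
      rw [weight, Fin.val_zero, zero_add, Nat.add_sub_cancel]
    have weight_succ (a : Fin N) : weight q a.succ = weight q a := by
      rw [weight, weight, Fin.val_succ, Nat.add_sub_add_right]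
    rw [Fin.sum_univ_succ, weight_zero]
    cases b using Fin.cases with
    | zero =>
      simp only [if_true, Fin.succ_ne_zero, Fin.not_lt_zero, if_false, mul_zero,
        Finset.sum_const_zero, add_zero]
      ring
    | succ b =>
      simp only [weight_succ, Fin.succ_inj, Fin.succ_lt_succ_iff, ih b, (Fin.succ_ne_zero b).symm,
        Fin.succ_pos, if_true, if_false]
      linear_combination -q ^ (2 * N) * mul_self_eq_one_add_lam_mul hq0

theorem Rhat_apply (q : K) (x y : Fin N × Fin N) :
    Rhat q x y = (if y = x.swap then if x.1 = x.2 then q else 1 else 0)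
      + if y = x then if x.1 < x.2 then lam q else 0 else 0 := by
  have h : Rhat q x y = Rmat q x.swap y := by
    rw [Rhat, Matrix.mul_apply, Fintype.sum_eq_single x.swap]
    · simp [Pmat]
    · rintro z hz
      have : ¬(x.1 = z.2 ∧ x.2 = z.1) := fun h => hz (Prod.ext h.2.symm h.1.symm)
      simp [Pmat, this]
  obtain ⟨a, b⟩ := x
  obtain ⟨c, d⟩ := y
  rw [h]
  simp only [Rmat, Matrix.of_apply, Prod.swap, Prod.mk.injEq]
  grind

variable {A : Type*} [Ring A] [Algebra K A]

theorem num_Rhat_mul_apply (M : Matrix (Fin N × Fin N) (Fin N × Fin N) A)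
    (x y : Fin N × Fin N) :
    (num A (Rhat (N := N) q) * M) x y = (if x.1 = x.2 then q else 1) • M x.swap y
      + (if x.1 < x.2 then lam q else 0) • M x y := by
  simp only [Matrix.mul_apply, num, Matrix.map_apply, ← Algebra.smul_def, Rhat_apply, add_smul,
    ite_zero_smul, Finset.sum_add_distrib, Finset.sum_ite_eq', Finset.mem_univ, if_true]

theorem Rhat_transpose (q : K) : (Rhat q : Matrix (Fin N × Fin N) _ K).transpose = Rhat q := by
  ext x y
  simp only [Matrix.transpose_apply, Rhat_apply]
  obtain ⟨a, b⟩ := x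
  obtain ⟨c, d⟩ := y
  grind

theorem mul_num_Rhat_apply (M : Matrix (Fin N × Fin N) (Fin N × Fin N) A)
    (x y : Fin N × Fin N) :
    (M * num A (Rhat (N := N) q)) x y = (if y.1 = y.2 then q else 1) • M x y.swap
      + (if y.1 < y.2 then lam q else 0) • M x y := by
  rw [← Rhat_transpose]
  simp only [Matrix.mul_apply, num, Matrix.map_apply, Matrix.transpose_apply, ← Algebra.commutes,
    ← Algebra.smul_def, Rhat_apply, add_smul, ite_zero_smul, Finset.sum_add_distrib,
    Finset.sum_ite_eq', Finset.mem_univ, if_true]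

theorem Rhat_mul_self (hq0 : q ≠ 0) :
    Rhat q * Rhat q = (1 : Matrix (Fin N × Fin N) (Fin N × Fin N) K) + lam q • Rhat q := by
  ext x y
  have h := num_Rhat_mul_apply (q := q) (Rhat q) x y
  have hq := mul_self_eq_one_add_lam_mul hq0
  obtain ⟨a, b⟩ := x
  obtain ⟨c, d⟩ := y
  simp only [num, Algebra.algebraMap_self, RingHom.coe_id, Matrix.map_id] at h
  rw [h]
  clear h
  simp only [Rhat_apply, Matrix.add_apply, Matrix.smul_apply, Matrix.one_apply, smul_eq_mul,
    Prod.swap]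
  grind

end Numeric

section QuantumTrace

variable {K : Type*} [Field K] {N : ℕ} {A : Type*} [Ring A] [Algebra K A] {q : K}
  (X Y : Matrix (Fin N) (Fin N) A) (M : Matrix (Fin N × Fin N) (Fin N × Fin N) A)

theorem in2_apply (a b c d : Fin N) : in2 X (a, b) (c, d) = if a = c then X b d else 0 := by
  rw [in2, Matrix.kronecker_apply, Matrix.one_apply, ite_mul, one_mul, zero_mul]

theorem in1_apply (a b c d : Fin N) : in1 X (a, b) (c, d) = if b = d then X a c else 0 := by
  rw [in1, Matrix.kronecker_apply, Matrix.one_apply, mul_ite, mul_one, mul_zero]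

theorem in2_eq_comp : in2 X = Matrix.compRingEquiv _ _ A (Matrix.scalar (Fin N) X) := by
  ext ⟨a, b⟩ ⟨c, d⟩
  rw [in2_apply, Matrix.compRingEquiv_apply, Matrix.comp_apply, Matrix.scalar_apply,
    Matrix.diagonal_apply]
  split_ifs <;> rfl

theorem in1_eq_comp :
    in1 X = Matrix.compRingEquiv _ _ A (X.map (Matrix.scalar (Fin N))) := by
  ext ⟨a, b⟩ ⟨c, d⟩
  rw [in1_apply, Matrix.compRingEquiv_apply, Matrix.comp_apply, Matrix.map_apply,
    Matrix.scalar_apply, Matrix.diagonal_apply]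

theorem in2_mul : in2 (X * Y) = in2 X * in2 Y := by
  simp only [in2_eq_comp, map_mul]

theorem in1_mul : in1 (X * Y) = in1 X * in1 Y := by
  simp only [in1_eq_comp, Matrix.map_mul, map_mul]

theorem in2_one : in2 (1 : Matrix (Fin N) (Fin N) A) = 1 :=
  Matrix.one_kronecker_one

theorem in1_one : in1 (1 : Matrix (Fin N) (Fin N) A) = 1 :=
  Matrix.one_kronecker_one

theorem in2_add : in2 (X + Y) = in2 X + in2 Y :=
  Matrix.kronecker_add _ _ _

theorem in1_add : in1 (X + Y) = in1 X + in1 Y :=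
  Matrix.add_kronecker _ _ _

theorem in2_smul (r : K) : in2 (r • X) = r • in2 X :=
  Matrix.kronecker_smul _ _ _

theorem in1_smul (r : K) : in1 (r • X) = r • in1 X :=
  Matrix.smul_kronecker _ _ _

/-- `trq` as a linear map. -/
def qTrace (q : K) : Matrix (Fin N) (Fin N) A →ₗ[K] A :=
  Matrix.traceLinearMap (Fin N) K A ∘ₗ LinearMap.mulLeft K (num A (Dinv q))

theorem qTrace_apply (q : K) : qTrace q X = ∑ a, weight q a • X a a := by
  simp only [qTrace, LinearMap.comp_apply, LinearMap.mulLeft_apply, Matrix.traceLinearMap_apply,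
    Matrix.trace, Matrix.diag_apply, num, Dinv, Matrix.diagonal_map (map_zero _),
    Matrix.diagonal_mul, weight, Algebra.smul_def]

theorem qTrace_mul_scalar (a : A) : qTrace q (X * Matrix.scalar (Fin N) a) = qTrace q X * a := by
  simp only [qTrace_apply, Matrix.scalar_apply, Matrix.mul_diagonal, Finset.sum_mul,
    smul_mul_assoc]

theorem qTrace_scalar_mul (a : A) : qTrace q (Matrix.scalar (Fin N) a * X) = a * qTrace q X := by
  simp only [qTrace_apply, Matrix.scalar_apply, Matrix.diagonal_mul, Finset.mul_sum,
    mul_smul_comm]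

theorem qTrace_mapMatrix {B : Type*} [Ring B] [Algebra K B] (f : A →ₐ[K] B) :
    qTrace q (f.mapMatrix X) = f (qTrace q X) := by
  simp only [qTrace_apply, map_sum, map_smul, AlgHom.mapMatrix_apply, Matrix.map_apply]

/-- The partial quantum trace over the first tensor factor: a matrix indexed by pairs is read as a
matrix of blocks, of which `qTrace` is taken. -/
def ptr (q : K) :
    Matrix (Fin N × Fin N) (Fin N × Fin N) A →ₗ[K] Matrix (Fin N) (Fin N) A :=
  qTrace q ∘ₗ (Matrix.compAlgEquiv (Fin N) (Fin N) A K).symm.toLinearMap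

theorem ptr_apply (b d : Fin N) : ptr q M b d = ∑ a, weight q a • M (a, b) (a, d) := by
  simp only [ptr, LinearMap.comp_apply, qTrace_apply, Matrix.sum_apply, Matrix.smul_apply]
  rfl

theorem ptr_comp (Z : Matrix (Fin N) (Fin N) (Matrix (Fin N) (Fin N) A)) :
    ptr q (Matrix.compRingEquiv _ _ A Z) = qTrace q Z :=
  rfl

theorem ptr_in2_mul : ptr q (in2 X * M) = X * ptr q M := by
  obtain ⟨M, rfl⟩ := (Matrix.compRingEquiv (Fin N) (Fin N) A).surjective M
  rw [in2_eq_comp, ← map_mul, ptr_comp, ptr_comp, qTrace_scalar_mul]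

theorem ptr_mul_in2 : ptr q (M * in2 X) = ptr q M * X := by
  obtain ⟨M, rfl⟩ := (Matrix.compRingEquiv (Fin N) (Fin N) A).surjective M
  rw [in2_eq_comp, ← map_mul, ptr_comp, ptr_comp, qTrace_mul_scalar]

theorem ptr_in1 : ptr q (in1 X) = Matrix.scalar (Fin N) (qTrace q X) := by
  rw [in1_eq_comp, ptr_comp]
  exact qTrace_mapMatrix X (Matrix.scalarAlgHom (Fin N) K)

theorem Rhat_inv (hq0 : q ≠ 0) :
    (Rhat q : Matrix (Fin N × Fin N) (Fin N × Fin N) K)⁻¹ = Rhat q - lam q • 1 := by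
  refine Matrix.inv_eq_right_inv ?_
  rw [mul_sub, Rhat_mul_self hq0, Matrix.mul_smul, mul_one, add_sub_cancel_right]

/-- `R̂` as an invertible matrix over `A`. -/
noncomputable def braid (A : Type*) [Ring A] [Algebra K A] (N : ℕ) (hq0 : q ≠ 0) :
    (Matrix (Fin N × Fin N) (Fin N × Fin N) A)ˣ :=
  Units.map (MonoidHomClass.toMonoidHom (Algebra.ofId K A).mapMatrix)
    { val := Rhat (N := N) q
      inv := (Rhat q)⁻¹
      val_inv := by
        rw [Rhat_inv hq0, mul_sub, Rhat_mul_self hq0, Matrix.mul_smul, mul_one,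
          add_sub_cancel_right]
      inv_val := by
        rw [Rhat_inv hq0, sub_mul, Rhat_mul_self hq0, Matrix.smul_mul, one_mul,
          add_sub_cancel_right] }

variable (hq0 : q ≠ 0)

local notation "R̂" => Units.val (braid A N hq0)
local notation "R̂⁻¹" => Units.val (braid A N hq0)⁻¹

theorem braid_inv : R̂⁻¹ = R̂ - lam q • 1 := by
  have h := congrArg (Algebra.ofId K A).mapMatrix (Rhat_inv (N := N) hq0)
  rwa [map_sub, map_smul, map_one] at h

theorem braid_eq_inv_add : R̂ = R̂⁻¹ + lam q • 1 :=
  sub_eq_iff_eq_add.mp (braid_inv hq0).symm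

theorem braid_mul_apply (x y : Fin N × Fin N) :
    (R̂ * M) x y = (if x.1 = x.2 then q else 1) • M x.swap y
      + (if x.1 < x.2 then lam q else 0) • M x y :=
  num_Rhat_mul_apply M x y

theorem mul_braid_apply (x y : Fin N × Fin N) :
    (M * R̂) x y = (if y.1 = y.2 then q else 1) • M x y.swap
      + (if y.1 < y.2 then lam q else 0) • M x y :=
  mul_num_Rhat_apply M x y

theorem ptr_braid : ptr q R̂ = q ^ (2 * N) • 1 := by
  have entry (a b d : Fin N) :
      R̂ (a, b) (a, d) = (if a = b then q else if a < b then lam q else 0) •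
        (1 : Matrix (Fin N) (Fin N) A) b d := by
    rw [← mul_one R̂, braid_mul_apply]
    simp only [Matrix.one_apply, Prod.swap, Prod.mk.injEq]
    grind [zero_smul, smul_zero, zero_add, add_zero]
  ext b d
  simp only [ptr_apply, entry, smul_smul, ← Finset.sum_smul, sum_weight_mul hq0,
    Matrix.smul_apply]

theorem ptr_braid_mul_in2_mul_braid :
    ptr q (R̂ * in2 X * R̂)
      = Matrix.scalar (Fin N) (qTrace q X) + (lam q * q ^ (2 * N)) • X := by
  have entry (a b d : Fin N) : (R̂ * in2 X * R̂) (a, b) (a, d) =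
      Matrix.scalar (Fin N) (X a a) b d +
        (lam q * if a = min b d then q else if a < min b d then lam q else 0) • X b d := by
    have hq (x : A) : (q * q) • x = x + (lam q * q) • x := by
      rw [mul_self_eq_one_add_lam_mul hq0, add_smul, one_smul]
    simp only [mul_braid_apply, braid_mul_apply, in2_apply, Prod.swap, Matrix.scalar_apply,
      Matrix.diagonal_apply, smul_add, smul_smul]
    grind [zero_smul, smul_zero, zero_add, add_zero, one_smul]
  ext b d
  have scalar_sum : Matrix.scalar (Fin N) (qTrace q X) b d
      = ∑ a, weight q a • Matrix.scalar (Fin N) (X a a) b d := by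
    simp only [qTrace_apply, Matrix.scalar_apply, Matrix.diagonal_apply]
    split_ifs <;> simp only [smul_zero, Finset.sum_const_zero]
  simp only [ptr_apply, entry, smul_add, Finset.sum_add_distrib, ← scalar_sum, smul_smul,
    mul_left_comm _ (lam q), ← Finset.mul_sum, ← Finset.sum_smul, sum_weight_mul hq0,
    Matrix.add_apply, Matrix.smul_apply]

theorem ptr_braid_mul_in2_mul_braid_inv :
    ptr q (R̂ * in2 X * R̂⁻¹) = Matrix.scalar (Fin N) (qTrace q X) := by
  rw [braid_inv hq0, mul_sub, map_sub,
    ptr_braid_mul_in2_mul_braid X hq0, mul_smul_comm, mul_one, map_smul, ptr_mul_in2,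
    ptr_braid hq0, smul_one_mul, smul_smul, add_sub_cancel_right]

theorem ptr_braid_inv_mul_in2_mul_braid :
    ptr q (R̂⁻¹ * in2 X * R̂) = Matrix.scalar (Fin N) (qTrace q X) := by
  rw [braid_inv hq0, sub_mul, sub_mul, map_sub,
    ptr_braid_mul_in2_mul_braid X hq0, smul_one_mul, smul_mul_assoc, map_smul, ptr_in2_mul,
    ptr_braid hq0, mul_smul_one, smul_smul, add_sub_cancel_right]

theorem qTrace_ptr : qTrace q (ptr q M)
    = ∑ x : Fin N × Fin N, (weight q x.1 * weight q x.2) • M x x := by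
  simp only [qTrace_apply, ptr_apply, Finset.smul_sum, smul_smul, Fintype.sum_prod_type_right,
    mul_comm]

theorem qTrace_ptr_braid_mul :
    qTrace q (ptr q (R̂ * M)) = qTrace q (ptr q (M * R̂)) := by
  have swap_sum : ∑ x : Fin N × Fin N, (weight q x.1 * weight q x.2) •
        (if x.1 = x.2 then q else 1) • M x.swap x
      = ∑ x : Fin N × Fin N, (weight q x.1 * weight q x.2) •
        (if x.1 = x.2 then q else 1) • M x x.swap :=
    Fintype.sum_equiv (Equiv.prodComm _ _) _ _ fun x => by
      simp only [Equiv.prodComm_apply, Prod.fst_swap, Prod.snd_swap, Prod.swap_swap, mul_comm,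
        eq_comm]
  simp only [qTrace_ptr, braid_mul_apply, mul_braid_apply, smul_add, Finset.sum_add_distrib,
    swap_sum]

theorem qTrace_mul_self_eq_zero (hq2 : q ^ 2 ≠ -1)
    (h : in2 X * R̂ * in2 X * R̂ = -(R̂⁻¹ * in2 X * R̂ * in2 X)) :
    qTrace q X * qTrace q X = 0 := by
  have conj : R̂ * (in2 X * R̂ * in2 X) * R̂ = -(in2 X * R̂ * in2 X) := by
    rw [mul_assoc, h, mul_neg]
    simp only [mul_assoc, Units.mul_inv_cancel_left]
  have trace_zero := trace_inv_mul_eq_zero (braid_eq_inv_add hq0)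
    (lam_sq_add_four_ne_zero hq0 hq2).isUnit (qTrace q ∘ₗ ptr q)
    (fun M => qTrace_ptr_braid_mul M hq0) conj
  rwa [← mul_assoc, ← mul_assoc, LinearMap.comp_apply, ptr_mul_in2,
    ptr_braid_inv_mul_in2_mul_braid X hq0, qTrace_scalar_mul] at trace_zero

theorem ptr_in1_mul_in2 :
    ptr q (in1 X * in2 Y) = Matrix.scalar (Fin N) (qTrace q X) * Y := by
  rw [ptr_mul_in2, ptr_in1]

theorem ptr_in2_mul_braid_conj :
    ptr q (in2 X * R̂ * in2 Y * R̂⁻¹) = X * Matrix.scalar (Fin N) (qTrace q Y) := by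
  rw [mul_assoc, mul_assoc, ← mul_assoc R̂, ptr_in2_mul, ptr_braid_mul_in2_mul_braid_inv]

theorem ptr_braid_inv_conj_mul_in2 :
    ptr q (R̂⁻¹ * in2 Y * R̂ * in2 X) = Matrix.scalar (Fin N) (qTrace q Y) * X := by
  rw [ptr_mul_in2, ptr_braid_inv_mul_in2_mul_braid]

theorem ptr_in2_mul_braid_mul_braid :
    ptr q (in2 X * R̂ * in2 Y * R̂)
      = X * Matrix.scalar (Fin N) (qTrace q Y) + (lam q * q ^ (2 * N)) • (X * Y) := by
  rw [mul_assoc, mul_assoc, ← mul_assoc R̂, ptr_in2_mul, ptr_braid_mul_in2_mul_braid, mul_add,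
    mul_smul_comm]

theorem mul_scalar_qTrace_of_unit {l : (Matrix (Fin N × Fin N) (Fin N × Fin N) A)ˣ}
    (hl : (l : Matrix (Fin N × Fin N) (Fin N × Fin N) A) = in2 Y)
    (h : in2 X * R̂ * l * R̂ = R̂ * l * R̂ * in2 X) :
    Y * Matrix.scalar (Fin N) (qTrace q X) = Matrix.scalar (Fin N) (qTrace q X) * Y := by
  have conj := (semiconjBy_of_mul_conj h).eq
  rw [hl, ← mul_assoc, ← mul_assoc] at conj
  simpa only [ptr_in2_mul_braid_conj, ptr_braid_inv_conj_mul_in2] using congrArg (ptr q) conj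

theorem mul_scalar_qTrace_add_of_braided
    (h : in2 X * R̂ * in2 X * R̂ = -(R̂⁻¹ * in2 X * R̂ * in2 X)) :
    X * Matrix.scalar (Fin N) (qTrace q X) + Matrix.scalar (Fin N) (qTrace q X) * X
      = -((lam q * q ^ (2 * N)) • X ^ 2) := by
  have trace := congrArg (ptr q) h
  rw [map_neg, ptr_in2_mul_braid_mul_braid, ptr_braid_inv_conj_mul_in2, ← sq] at trace
  linear_combination (norm := module) trace

theorem scalar_qTrace_mul_of_braided (h : in1 X * in2 Y = in2 Y * R̂ * in2 X * R̂) :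
    Matrix.scalar (Fin N) (qTrace q X) * Y
      = Y * Matrix.scalar (Fin N) (qTrace q X) + (lam q * q ^ (2 * N)) • (Y * X) := by
  simpa only [ptr_in1_mul_in2, ptr_in2_mul_braid_mul_braid] using congrArg (ptr q) h

theorem mul_scalar_qTrace_add_of_dual
    (h : in2 Y * R̂ * in2 X * R̂ + R̂ * in2 X * R̂ * in2 Y = -R̂) :
    Y * Matrix.scalar (Fin N) (qTrace q X) + Matrix.scalar (Fin N) (qTrace q X) * Y
      = -(q ^ (2 * N) • (1 + lam q • (Y * X) + lam q • (X * Y))) := by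
  have trace := congrArg (ptr q) h
  simp only [map_add, map_neg, ptr_in2_mul_braid_mul_braid, ptr_mul_in2,
    ptr_braid_mul_in2_mul_braid, ptr_braid, add_mul, smul_mul_assoc] at trace
  linear_combination (norm := module) trace

end QuantumTrace

section Relations

variable {K : Type*} [Field K] {N : ℕ} {A B : Type*} [Ring A] [Algebra K A] [Ring B] [Algebra K B]
  (f : A →ₐ[K] B) (X : Matrix (Fin N) (Fin N) A)

theorem mapMatrix_in2 : f.mapMatrix (in2 X) = in2 (f.mapMatrix X) := by
  ext ⟨a, b⟩ ⟨c, d⟩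
  simp only [AlgHom.mapMatrix_apply, Matrix.map_apply, in2_apply, apply_ite f, map_zero]

theorem mapMatrix_in1 : f.mapMatrix (in1 X) = in1 (f.mapMatrix X) := by
  ext ⟨a, b⟩ ⟨c, d⟩
  simp only [AlgHom.mapMatrix_apply, Matrix.map_apply, in1_apply, apply_ite f, map_zero]

theorem mapMatrix_num {m : Type*} [Fintype m] [DecidableEq m] (M : Matrix m m K) :
    f.mapMatrix (num A M) = num B M :=
  Matrix.ext fun _ _ => f.commutes _

/-- Six matrices over a `K`-algebra realizing the defining relations `Rel` as matrix identities:
`t, t'`, `l, l'`, `w`, `j` stand for `T, T⁻¹`, `L, L⁻¹`, `ω`, `J`. -/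
structure IsRealization (q : K) (t t' l l' w j : Matrix (Fin N) (Fin N) A) : Prop where
  om_om : in2 w * num A (Rhat q)⁻¹ * in2 w * num A (Rhat q)
    = -(num A (Rhat q)⁻¹ * in2 w * num A (Rhat q)⁻¹ * in2 w)
  om_L : in2 w * num A (Rhat q) * in2 l * num A (Rhat q)
    = num A (Rhat q) * in2 l * num A (Rhat q) * in2 w
  om_J : in2 w * num A (Rhat q) * in2 j * num A (Rhat q)
    + num A (Rhat q) * in2 j * num A (Rhat q) * in2 w = -num A (Rhat q)
  L_L : in2 l * num A (Rhat q) * in2 l * num A (Rhat q)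
    = num A (Rhat q) * in2 l * num A (Rhat q) * in2 l
  J_L : in2 j * num A (Rhat q) * in2 l * num A (Rhat q)
    = num A (Rhat q) * in2 l * num A (Rhat q) * in2 j
  J_J : in2 j * num A (Rhat q) * in2 j * num A (Rhat q)
    = -(num A (Rhat q)⁻¹ * in2 j * num A (Rhat q) * in2 j)
  T_T : num A (Rhat q) * in1 t * in2 t = in1 t * in2 t * num A (Rhat q)
  om_T : in1 w * in2 t = in2 t * num A (Rhat q)⁻¹ * in2 w * num A (Rhat q)⁻¹
  J_T : in1 j * in2 t = in2 t * num A (Rhat q) * in2 j * num A (Rhat q)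
  L_T : in1 l * in2 t = in2 t * num A (Rhat q) * in2 l * num A (Rhat q)
  T_Tinv : t * t' = 1
  Tinv_T : t' * t = 1
  L_Linv : l * l' = 1
  Linv_L : l' * l = 1

theorem IsRealization.smul {q : K} {t t' l l' w j : Matrix (Fin N) (Fin N) A}
    (h : IsRealization q t t' l l' w j) {r s : K} (hrs : r * s = 1) :
    IsRealization q t t' l l' (r • w) (s • j) where
  om_om := by simp only [in2_smul, smul_mul_assoc, mul_smul_comm, h.om_om, smul_neg]
  om_L := by simp only [in2_smul, smul_mul_assoc, mul_smul_comm, h.om_L]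
  om_J := by
    simp only [in2_smul, smul_mul_assoc, mul_smul_comm, smul_smul, mul_comm s, hrs, one_smul,
      h.om_J]
  L_L := h.L_L
  J_L := by simp only [in2_smul, smul_mul_assoc, mul_smul_comm, h.J_L]
  J_J := by simp only [in2_smul, smul_mul_assoc, mul_smul_comm, h.J_J, smul_neg]
  T_T := h.T_T
  om_T := by simp only [in1_smul, in2_smul, smul_mul_assoc, mul_smul_comm, h.om_T]
  J_T := by simp only [in1_smul, in2_smul, smul_mul_assoc, mul_smul_comm, h.J_T]
  L_T := h.L_T
  T_Tinv := h.T_Tinv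
  Tinv_T := h.Tinv_T
  L_Linv := h.L_Linv
  Linv_L := h.Linv_L

theorem rel_iff_isRealization (q : K) (f : FreeAlgebra K (Gen N) →ₐ[K] A) :
    (∀ ⦃x y⦄, Rel N q x y → f x = f y) ↔
      IsRealization q (f.mapMatrix (freeT K N)) (f.mapMatrix (freeTinv K N))
        (f.mapMatrix (freeL K N)) (f.mapMatrix (freeLinv K N)) (f.mapMatrix (freeOm K N))
        (f.mapMatrix (freeJ K N)) := by
  have map_freeR : f.mapMatrix (freeR K N q) = num A (Rhat q) := mapMatrix_num f _
  have map_freeRinv : f.mapMatrix (freeRinv K N q) = num A (Rhat q)⁻¹ := mapMatrix_num f _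
  constructor
  · intro h
    have eq_of_rel {m : Type} [Fintype m] [DecidableEq m]
        {X Y : Matrix m m (FreeAlgebra K (Gen N))} (hXY : ∀ a b, Rel N q (X a b) (Y a b)) :
        f.mapMatrix X = f.mapMatrix Y :=
      Matrix.ext fun a b => h (hXY a b)
    constructor <;>
      simp only [← mapMatrix_in2, ← mapMatrix_in1, ← map_freeR, ← map_freeRinv, ← map_mul,
        ← map_add, ← map_neg, ← map_one f.mapMatrix]
    exacts [eq_of_rel Rel.om_om, eq_of_rel Rel.om_L, eq_of_rel Rel.om_J, eq_of_rel Rel.L_L,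
      eq_of_rel Rel.J_L, eq_of_rel Rel.J_J, eq_of_rel Rel.T_T, eq_of_rel Rel.om_T,
      eq_of_rel Rel.J_T, eq_of_rel Rel.L_T, eq_of_rel Rel.T_Tinv, eq_of_rel Rel.Tinv_T,
      eq_of_rel Rel.L_Linv, eq_of_rel Rel.Linv_L]
  · intro h x y hxy
    have entry {m : Type} [Fintype m] [DecidableEq m]
        {X Y : Matrix m m (FreeAlgebra K (Gen N))} (hXY : f.mapMatrix X = f.mapMatrix Y)
        (a b : m) : f (X a b) = f (Y a b) :=
      congrFun₂ hXY a b
    cases hxy <;> refine entry ?_ _ _ <;>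
      simp only [map_mul, map_add, map_neg, map_one, mapMatrix_in1, mapMatrix_in2, map_freeR,
        map_freeRinv]
    exacts [h.om_om, h.om_L, h.om_J, h.L_L, h.J_L, h.J_J, h.T_T, h.om_T, h.J_T, h.L_T, h.T_Tinv,
      h.Tinv_T, h.L_Linv, h.Linv_L]

/-- The matrix `T⁻¹` over the differential algebra. -/
noncomputable def Tinv (N : ℕ) (q : K) : Matrix (Fin N) (Fin N) (DiffAlg N q) :=
  Matrix.of fun i j => gen N q (Gen.Tinv i j)

theorem isRealization_gen (N : ℕ) (q : K) :
    IsRealization q (T N q) (Tinv N q) (L N q) (Linv N q) (om N q) (J N q) :=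
  (rel_iff_isRealization q (RingQuot.mkAlgHom K (Rel N q))).mp fun _ _ h =>
    RingQuot.mkAlgHom_rel K h

end Relations

section Commutation

variable {K : Type*} [Field K] {N : ℕ} {q : K}

/-- `L₂` as an invertible matrix over the differential algebra. -/
noncomputable def in2L (N : ℕ) (q : K) :
    (Matrix (Fin N × Fin N) (Fin N × Fin N) (DiffAlg N q))ˣ where
  val := in2 (L N q)
  inv := in2 (Linv N q)
  val_inv := by rw [← in2_mul, (isRealization_gen N q).L_Linv, in2_one]
  inv_val := by rw [← in2_mul, (isRealization_gen N q).Linv_L, in2_one]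

/-- `L₁` as an invertible matrix over the differential algebra. -/
noncomputable def in1L (N : ℕ) (q : K) :
    (Matrix (Fin N × Fin N) (Fin N × Fin N) (DiffAlg N q))ˣ where
  val := in1 (L N q)
  inv := in1 (Linv N q)
  val_inv := by rw [← in1_mul, (isRealization_gen N q).L_Linv, in1_one]
  inv_val := by rw [← in1_mul, (isRealization_gen N q).Linv_L, in1_one]

theorem in2_Wbar : in2 (Wbar N q) = 1 + lam q • (in2 (J N q) * in2 (om N q)) := by
  rw [Wbar, in2_add, in2_one, in2_smul, in2_mul]

theorem in2_ThetaStar :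
    in2 (ThetaStar N q) = in2 (J N q) * Units.val (in2L N q)⁻¹ * in2 (Wbar N q) := by
  rw [ThetaStar, in2_mul, in2_mul]
  rfl

theorem in1_ThetaStar : in1 (ThetaStar N q) = in1 (J N q) * Units.val (in1L N q)⁻¹ *
    (1 + lam q • (in1 (J N q) * in1 (om N q))) := by
  rw [ThetaStar, in1_mul, in1_mul, in1_add, in1_one, in1_smul, in1_mul]
  rfl

variable (hq0 : q ≠ 0)

local notation "R̂" => Units.val (braid (DiffAlg N q) N hq0)
local notation "R̂⁻¹" => Units.val (braid (DiffAlg N q) N hq0)⁻¹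

theorem in2_J_mul_Wbar :
    in2 (J N q) * R̂ * in2 (Wbar N q) * R̂⁻¹ = R̂ * in2 (Wbar N q) * R̂ * in2 (J N q) := by
  rw [in2_Wbar]
  exact J_mul_Wbar (braid_eq_inv_add hq0) (isRealization_gen N q).J_J (isRealization_gen N q).om_J

theorem in2_om_mul_Wbar :
    in2 (om N q) * R̂ * in2 (Wbar N q) * R̂ = R̂ * in2 (Wbar N q) * R̂⁻¹ * in2 (om N q) := by
  rw [in2_Wbar]
  exact om_mul_Wbar (braid_eq_inv_add hq0) (isRealization_gen N q).om_om
    (isRealization_gen N q).om_J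

theorem in2_J_mul_ThetaStar : in2 (J N q) * R̂ * in2 (ThetaStar N q) * R̂⁻¹
    = -(R̂⁻¹ * in2 (ThetaStar N q) * R̂ * in2 (J N q)) := by
  rw [in2_ThetaStar]
  exact J_mul_Theta (isRealization_gen N q).J_J (isRealization_gen N q).J_L (in2_J_mul_Wbar hq0)

theorem in2_om_mul_ThetaStar : in2 (om N q) * R̂ * in2 (ThetaStar N q) * R̂
    = -(in2 (Linv N q) * in2 (Wbar N q) * R̂) - R̂ * in2 (ThetaStar N q) * R̂⁻¹ * in2 (om N q) := by
  rw [in2_ThetaStar]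
  exact om_mul_Theta (l := in2L N q) (isRealization_gen N q).om_J (isRealization_gen N q).om_L
    (in2_om_mul_Wbar hq0)

theorem in2_ThetaStar_mul_L : in2 (ThetaStar N q) * R̂ * in2 (L N q) * R̂
    = R̂ * in2 (L N q) * R̂ * in2 (ThetaStar N q) := by
  rw [in2_ThetaStar, in2_Wbar]
  exact Theta_mul_L (l := in2L N q) (isRealization_gen N q).L_L (isRealization_gen N q).J_L
    (isRealization_gen N q).om_L

theorem in2_ThetaStar_mul_ThetaStar : in2 (ThetaStar N q) * R̂ * in2 (ThetaStar N q) * R̂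
    = -(R̂⁻¹ * in2 (ThetaStar N q) * R̂ * in2 (ThetaStar N q)) :=
  Theta_mul_Theta in2_ThetaStar (in2_ThetaStar_mul_L hq0) (in2_J_mul_ThetaStar hq0)
    (Wbar_mul_Theta (braid_eq_inv_add hq0) in2_Wbar in2_ThetaStar (in2_J_mul_ThetaStar hq0)
      (in2_om_mul_ThetaStar hq0))

theorem in1_ThetaStar_mul_T : in1 (ThetaStar N q) * in2 (T N q)
    = in2 (T N q) * R̂ * in2 (ThetaStar N q) * R̂⁻¹ := by
  rw [in1_ThetaStar, in2_ThetaStar, in2_Wbar]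
  exact Theta_mul_T (l := in2L N q) (l₁ := in1L N q) (isRealization_gen N q).J_T
    (isRealization_gen N q).L_T (isRealization_gen N q).om_T

end Commutation

section AntiBRST

variable {K : Type*} [Field K] {N : ℕ} {q : K}

local notation "trΘ" => Matrix.scalar (Fin N) (qTrace q (ThetaStar N q))
local notation "trJ" => Matrix.scalar (Fin N) (qTrace q (J N q))
local notation "Q⋆" => Matrix.scalar (Fin N) (Qstar N q)

theorem J_mul_qTrace_ThetaStar (hq0 : q ≠ 0) : J N q * trΘ = -(trΘ * J N q) := by
  simpa only [ptr_in2_mul_braid_conj, ptr_braid_inv_conj_mul_in2, map_neg]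
    using congrArg (ptr q) (in2_J_mul_ThetaStar (N := N) hq0)

theorem qTrace_ThetaStar_mul_T (hq0 : q ≠ 0) : trΘ * T N q = T N q * trΘ := by
  simpa only [ptr_in2_mul_braid_conj, ptr_in1_mul_in2]
    using congrArg (ptr q) (in1_ThetaStar_mul_T (N := N) hq0)

theorem om_mul_qTrace_ThetaStar_add (hq0 : q ≠ 0) :
    om N q * trΘ + trΘ * om N q = -(q ^ (2 * N) • (W N q * Linv N q * Wbar N q)) := by
  have h := congrArg (ptr q) (in2_om_mul_ThetaStar (N := N) hq0)
  simp only [ptr_in2_mul_braid_mul_braid, map_sub, map_neg, ← in2_mul, ptr_in2_mul, ptr_mul_in2,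
    ptr_braid, ptr_braid_mul_in2_mul_braid_inv, mul_smul_one] at h
  have W_mul : W N q * Linv N q * Wbar N q
      = Linv N q * Wbar N q + lam q • (om N q * ThetaStar N q) := by
    simp only [W, ThetaStar, Wbar, add_mul, one_mul, smul_mul_assoc, mul_assoc]
  rw [W_mul]
  linear_combination (norm := module) h

theorem L_mul_qTrace_ThetaStar (hq0 : q ≠ 0) : L N q * trΘ = trΘ * L N q :=
  mul_scalar_qTrace_of_unit _ _ hq0 (l := in2L N q) rfl (in2_ThetaStar_mul_L hq0)

theorem L_mul_qTrace_J (hq0 : q ≠ 0) : L N q * trJ = trJ * L N q :=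
  mul_scalar_qTrace_of_unit _ _ hq0 (l := in2L N q) rfl (isRealization_gen N q).J_L

theorem J_mul_qTrace_J_add (hq0 : q ≠ 0) :
    J N q * trJ + trJ * J N q = -((lam q * q ^ (2 * N)) • J N q ^ 2) :=
  mul_scalar_qTrace_add_of_braided _ hq0 (isRealization_gen N q).J_J

theorem qTrace_J_mul_T (hq0 : q ≠ 0) :
    trJ * T N q = T N q * trJ + (lam q * q ^ (2 * N)) • (T N q * J N q) :=
  scalar_qTrace_mul_of_braided _ _ hq0 (isRealization_gen N q).J_T

theorem om_mul_qTrace_J_add (hq0 : q ≠ 0) : om N q * trJ + trJ * om N q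
    = -(q ^ (2 * N) • (W N q * Wbar N q - lam q ^ 2 • (om N q * J N q ^ 2 * om N q))) := by
  have W_mul_Wbar : W N q * Wbar N q - lam q ^ 2 • (om N q * J N q ^ 2 * om N q)
      = 1 + lam q • (om N q * J N q) + lam q • (J N q * om N q) := by
    simp only [W, Wbar, sq, add_mul, mul_add, one_mul, mul_one, smul_mul_assoc, mul_smul_comm,
      mul_assoc]
    module
  rw [W_mul_Wbar]
  exact mul_scalar_qTrace_add_of_dual _ _ hq0 (isRealization_gen N q).om_J

theorem Qstar_eq_smul_qTrace_sub :
    Qstar N q = (lam q)⁻¹ • (qTrace q (ThetaStar N q) - qTrace q (J N q)) :=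
  rfl

theorem scalar_Qstar : Q⋆ = (lam q)⁻¹ • (trΘ - trJ) := by
  rw [Qstar_eq_smul_qTrace_sub, ← map_sub (Matrix.scalar (Fin N))]
  exact map_smul (Matrix.scalarAlgHom (Fin N) K) _ _

theorem Qstar_eq_trq (hq0 : q ≠ 0) (hq1 : q ^ 2 ≠ 1) :
    Qstar N q = trq q (J N q * ((lam q)⁻¹ • (Linv N q - 1))
      + J N q * Linv N q * J N q * om N q) := by
  have hc := lam_ne_zero hq0 hq1
  rw [Qstar_eq_smul_qTrace_sub, ← map_sub, ← map_smul]
  change trq q _ = _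
  congr 1
  simp only [ThetaStar, mul_add, mul_one, mul_sub, mul_smul_comm, smul_sub, smul_add,
    inv_smul_smul₀ hc, mul_assoc]
  abel

theorem Qstar_mul_self (hq0 : q ≠ 0) (hq2 : q ^ 2 ≠ -1) : Qstar N q * Qstar N q = 0 := by
  have hJ := qTrace_mul_self_eq_zero _ hq0 hq2 (isRealization_gen N q).J_J
  have hΘ := qTrace_mul_self_eq_zero _ hq0 hq2 (in2_ThetaStar_mul_ThetaStar (N := N) hq0)
  have hJΘ := congrArg (qTrace q) (J_mul_qTrace_ThetaStar (N := N) hq0)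
  rw [qTrace_mul_scalar, map_neg, qTrace_scalar_mul] at hJΘ
  simp only [Qstar_eq_smul_qTrace_sub, smul_mul_assoc, mul_smul_comm, sub_mul, mul_sub, hJ, hΘ,
    hJΘ, zero_sub, sub_zero, neg_neg, sub_self, smul_zero]

theorem Qstar_commutator_L (hq0 : q ≠ 0) : Q⋆ * L N q - L N q * Q⋆ = 0 := by
  simp only [scalar_Qstar, smul_mul_assoc, mul_smul_comm, sub_mul, mul_sub,
    L_mul_qTrace_ThetaStar hq0, L_mul_qTrace_J hq0, sub_self]

theorem Qstar_commutator_T (hq0 : q ≠ 0) (hq1 : q ^ 2 ≠ 1) :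
    Q⋆ * T N q - T N q * Q⋆ = -(q ^ (2 * N) • (T N q * J N q)) := by
  simp only [scalar_Qstar, smul_mul_assoc, mul_smul_comm, sub_mul, mul_sub,
    qTrace_ThetaStar_mul_T hq0, qTrace_J_mul_T hq0, smul_add, smul_sub, mul_smul,
    inv_smul_smul₀ (lam_ne_zero hq0 hq1)]
  abel

theorem Qstar_mul_add (X : Matrix (Fin N) (Fin N) (DiffAlg N q)) :
    Q⋆ * X + X * Q⋆ = (lam q)⁻¹ • ((X * trΘ + trΘ * X) - (X * trJ + trJ * X)) := by
  simp only [scalar_Qstar, smul_mul_assoc, mul_smul_comm, sub_mul, mul_sub]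
  module

theorem Qstar_anticommutator_J (hq0 : q ≠ 0) (hq1 : q ^ 2 ≠ 1) :
    Q⋆ * J N q + J N q * Q⋆ = q ^ (2 * N) • J N q ^ 2 := by
  rw [Qstar_mul_add, J_mul_qTrace_ThetaStar hq0, J_mul_qTrace_J_add hq0, neg_add_cancel, zero_sub,
    neg_neg, mul_smul, inv_smul_smul₀ (lam_ne_zero hq0 hq1)]

theorem Qstar_anticommutator_om (hq0 : q ≠ 0) (hq1 : q ^ 2 ≠ 1) :
    Q⋆ * om N q + om N q * Q⋆
      = q ^ (2 * N) • (W N q * ((lam q)⁻¹ • (1 - Linv N q)) * Wbar N q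
            - lam q • (om N q * J N q ^ 2 * om N q)) := by
  have lam_smul : lam q • (om N q * J N q ^ 2 * om N q)
      = (lam q)⁻¹ • lam q ^ 2 • (om N q * J N q ^ 2 * om N q) := by
    rw [sq (lam q), mul_smul, inv_smul_smul₀ (lam_ne_zero hq0 hq1)]
  rw [Qstar_mul_add, om_mul_qTrace_ThetaStar_add hq0, om_mul_qTrace_J_add hq0, lam_smul]
  simp only [mul_smul_comm, smul_mul_assoc, mul_sub, sub_mul, mul_one]
  module

end AntiBRST

section TwistedCommutator

variable {K A : Type*} [CommRing K] [Ring A] [Algebra K A] (σ : A →ₐ[K] A) (Q : A)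

/-- The twisted commutator `a ↦ Q a - σ(a) Q`; when `σ` is the parity automorphism of a graded
algebra this is the graded commutator with an odd element `Q`. -/
def twistedCommutator : A →ₗ[K] A :=
  LinearMap.mulLeft K Q - LinearMap.mulRight K Q ∘ₗ σ.toLinearMap

theorem twistedCommutator_apply (a : A) : twistedCommutator σ Q a = Q * a - σ a * Q :=
  rfl

theorem twistedCommutator_mul (a b : A) : twistedCommutator σ Q (a * b)
    = twistedCommutator σ Q a * b + σ a * twistedCommutator σ Q b := by
  simp only [twistedCommutator_apply, map_mul]
  noncomm_ring

variable {σ Q}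

theorem twistedCommutator_twistedCommutator (hσ : σ Q = -Q) (hQ : Q * Q = 0) (a : A) :
    twistedCommutator σ Q (twistedCommutator σ Q a) = 0 := by
  simp only [twistedCommutator_apply, map_sub, map_mul, hσ]
  linear_combination (norm := noncomm_ring) hQ * a - σ (σ a) * hQ

end TwistedCommutator

section Grading

variable {K : Type*} [Field K] {N : ℕ} {q : K}

theorem gen_mem_homog (g : Gen N) : gen N q g ∈ homog N q g.deg :=
  Submodule.subset_span ⟨[g], by simp, by simp⟩

instance : SetLike.GradedMonoid (homog N q) where
  one_mem := Submodule.subset_span ⟨[], by simp, by simp⟩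
  mul_mem m n a b ha hb := by
    suffices homog N q m * homog N q n ≤ homog N q (m + n) from this (Submodule.mul_mem_mul ha hb)
    rw [homog, homog, Submodule.span_mul_span, homog]
    refine Submodule.span_mono ?_
    rintro _ ⟨_, ⟨v, rfl, rfl⟩, _, ⟨w, rfl, rfl⟩, rfl⟩
    exact ⟨v ++ w, by simp, by simp⟩

theorem adjoin_range_gen : Algebra.adjoin K (Set.range (gen N q)) = ⊤ := by
  have range_gen : Set.range (gen N q)
      = RingQuot.mkAlgHom K (Rel N q) '' Set.range (FreeAlgebra.ι K) :=
    Set.range_comp _ _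
  rw [range_gen, ← AlgHom.map_adjoin, FreeAlgebra.adjoin_range_ι, Algebra.map_top,
    AlgHom.range_eq_top]
  exact RingQuot.mkAlgHom_surjective K (Rel N q)

theorem iSup_homog : ⨆ n, homog N q n = ⊤ := by
  rw [eq_top_iff, ← Algebra.top_toSubmodule, ← adjoin_range_gen, Algebra.adjoin_eq_span,
    Submodule.span_le]
  have closure_le : Submonoid.closure (Set.range (gen N q))
      ≤ SetLike.homogeneousSubmonoid (homog N q) := by
    rw [Submonoid.closure_le, Set.range_subset_iff]
    exact fun g => ⟨g.deg, gen_mem_homog g⟩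
  intro a ha
  obtain ⟨n, hn⟩ := closure_le ha
  exact Submodule.mem_iSup_of_mem n hn

theorem linearMap_ext_homog {V : Type*} [AddCommMonoid V] [Module K V] {f g : DiffAlg N q →ₗ[K] V}
    (h : ∀ n : ℤ, ∀ a ∈ homog N q n, f a = g a) : f = g :=
  LinearMap.eqLocus_eq_top.mp (top_le_iff.mp (iSup_homog.symm.trans_le (iSup_le h)))

/-- The endomorphism multiplying each homogeneous element of degree `n` by `s ^ n`. -/
noncomputable def degreeScaling (N : ℕ) (q : K) (s : Kˣ) : DiffAlg N q →ₐ[K] DiffAlg N q :=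
  RingQuot.liftAlgHom K ⟨FreeAlgebra.lift K fun g => (s : K) ^ g.deg • gen N q g,
    (rel_iff_isRealization q _).mpr <| by
      convert (isRealization_gen N q).smul s.mul_inv using 1 <;>
        ext i j <;>
        simp [freeT, freeTinv, freeL, freeLinv, freeOm, freeJ, T, Tinv, L, Linv, om, J, Gen.deg]⟩

theorem degreeScaling_gen (s : Kˣ) (g : Gen N) :
    degreeScaling N q s (gen N q g) = (s : K) ^ g.deg • gen N q g := by
  rw [degreeScaling, gen, RingQuot.liftAlgHom_mkAlgHom_apply]
  exact FreeAlgebra.lift_ι_apply _ _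

theorem degreeScaling_of_mem_homog (s : Kˣ) {n : ℤ} {a : DiffAlg N q} (ha : a ∈ homog N q n) :
    degreeScaling N q s a = (s : K) ^ n • a := by
  induction ha using Submodule.span_induction with
  | mem a ha =>
    obtain ⟨w, rfl, rfl⟩ := ha
    induction w with
    | nil => simp
    | cons g w ih =>
      rw [List.map_cons, List.prod_cons, map_mul, ih, degreeScaling_gen, List.map_cons,
        List.sum_cons, zpow_add₀ s.ne_zero, smul_mul_smul_comm]
  | zero => rw [map_zero, smul_zero]
  | add a b _ _ iha ihb => rw [map_add, iha, ihb, smul_add]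
  | smul r a _ iha => rw [map_smul, iha, smul_comm]

/-- The graded commutator `a ↦ Q a - (-1)ⁿ a Q`, `n = deg a`, with an odd element `Q`. -/
noncomputable def gradedCommutator (Q : DiffAlg N q) : DiffAlg N q →ₗ[K] DiffAlg N q :=
  twistedCommutator (degreeScaling N q (-1)) Q

theorem degreeScaling_neg_one_of_mem_homog {n : ℤ} {a : DiffAlg N q} (ha : a ∈ homog N q n) :
    degreeScaling N q (-1) a = (-1 : K) ^ n • a := by
  simpa only [Units.val_neg, Units.val_one] using degreeScaling_of_mem_homog (-1) ha

theorem gradedCommutator_of_mem_homog (Q : DiffAlg N q) {n : ℤ} {a : DiffAlg N q}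
    (ha : a ∈ homog N q n) : gradedCommutator Q a = Q * a - (-1 : K) ^ n • (a * Q) := by
  rw [gradedCommutator, twistedCommutator_apply, degreeScaling_neg_one_of_mem_homog ha,
    smul_mul_assoc]

theorem gradedCommutator_mem_homog {Q : DiffAlg N q} {m n : ℤ} {a : DiffAlg N q}
    (hQ : Q ∈ homog N q m) (ha : a ∈ homog N q n) : gradedCommutator Q a ∈ homog N q (n + m) := by
  rw [gradedCommutator_of_mem_homog Q ha]
  refine Submodule.sub_mem _ ?_ (Submodule.smul_mem _ _ (SetLike.mul_mem_graded ha hQ))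
  exact add_comm n m ▸ SetLike.mul_mem_graded hQ ha

theorem existsUnique_differential {Q : DiffAlg N q} {m : ℤ} (hm : Odd m) (hQm : Q ∈ homog N q m)
    (hQ : Q * Q = 0) :
    ∃! d : DiffAlg N q →ₗ[K] DiffAlg N q,
      (∀ n : ℤ, ∀ a ∈ homog N q n, d a = Q * a - (-1 : K) ^ n • (a * Q)) ∧
      (∀ a, d (d a) = 0) ∧
      (∀ n : ℤ, ∀ a ∈ homog N q n, ∀ b, d (a * b) = d a * b + (-1 : K) ^ n • (a * d b)) ∧
      (∀ n : ℤ, ∀ a ∈ homog N q n, d a ∈ homog N q (n + m)) := by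
  have parity_Q : degreeScaling N q (-1) Q = -Q := by
    rw [degreeScaling_neg_one_of_mem_homog hQm, hm.neg_one_zpow]
    exact neg_one_smul K Q
  refine ⟨gradedCommutator Q, ⟨fun _ _ => gradedCommutator_of_mem_homog Q,
    twistedCommutator_twistedCommutator parity_Q hQ, fun n a ha b => ?_,
    fun _ _ => gradedCommutator_mem_homog hQm⟩, fun d hd => linearMap_ext_homog fun n a ha => ?_⟩
  · rw [← smul_mul_assoc, ← degreeScaling_neg_one_of_mem_homog ha]
    exact twistedCommutator_mul _ Q a b
  · rw [hd.1 n a ha, gradedCommutator_of_mem_homog Q ha]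

theorem matrix_mul_mem_homog {m n : ℤ} {X Y : Matrix (Fin N) (Fin N) (DiffAlg N q)}
    (hX : ∀ i j, X i j ∈ homog N q m) (hY : ∀ i j, Y i j ∈ homog N q n) (i j : Fin N) :
    (X * Y) i j ∈ homog N q (m + n) := by
  rw [Matrix.mul_apply]
  exact Submodule.sum_mem _ fun k _ => SetLike.mul_mem_graded (hX i k) (hY k j)

theorem trq_mem_homog {n : ℤ} {X : Matrix (Fin N) (Fin N) (DiffAlg N q)}
    (hX : ∀ i j, X i j ∈ homog N q n) : trq q X ∈ homog N q n := by
  change qTrace q X ∈ _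
  rw [qTrace_apply]
  exact Submodule.sum_mem _ fun i _ => Submodule.smul_mem _ _ (hX i i)

theorem J_mem_homog (i j : Fin N) : J N q i j ∈ homog N q (-1) :=
  gen_mem_homog (Gen.J i j)

theorem Wbar_mem_homog (i j : Fin N) : Wbar N q i j ∈ homog N q 0 := by
  have one_mem : (1 : Matrix (Fin N) (Fin N) (DiffAlg N q)) i j ∈ homog N q 0 := by
    rw [Matrix.one_apply]
    split_ifs
    exacts [SetLike.one_mem_graded _, Submodule.zero_mem _]
  exact Submodule.add_mem _ one_mem (Submodule.smul_mem _ _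
    (matrix_mul_mem_homog J_mem_homog (fun i j => gen_mem_homog (Gen.om i j)) i j))

theorem ThetaStar_mem_homog (i j : Fin N) : ThetaStar N q i j ∈ homog N q (-1) :=
  matrix_mul_mem_homog
    (matrix_mul_mem_homog J_mem_homog fun i j => gen_mem_homog (Gen.Linv i j)) Wbar_mem_homog i j

theorem Qstar_mem_homog : Qstar N q ∈ homog N q (-1) :=
  Submodule.smul_mem _ _
    (Submodule.sub_mem _ (trq_mem_homog ThetaStar_mem_homog) (trq_mem_homog J_mem_homog))

end Grading

section Entries

variable {n A : Type*} [Fintype n] [DecidableEq n] [Ring A] {a : A} {X Y : Matrix n n A}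

theorem commutator_apply_of_scalar
    (h : Matrix.scalar n a * X - X * Matrix.scalar n a = Y) (i j : n) :
    a * X i j - X i j * a = Y i j := by
  rw [← h, Matrix.sub_apply, Matrix.scalar_apply, Matrix.diagonal_mul, Matrix.mul_diagonal]

theorem anticommutator_apply_of_scalar
    (h : Matrix.scalar n a * X + X * Matrix.scalar n a = Y) (i j : n) :
    a * X i j + X i j * a = Y i j := by
  rw [← h, Matrix.add_apply, Matrix.scalar_apply, Matrix.diagonal_mul, Matrix.mul_diagonal]

end Entries

end QGL

theorem mainTheorem4 {K : Type*} [Field K] (N : ℕ) (q : K)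
    (hq0 : q ≠ 0) (hq1 : q ^ 2 ≠ 1) (hq2 : q ^ 2 ≠ -1) :
    -- the two expressions for the anti-BRST operator agree
    QGL.Qstar N q = QGL.trq q
      (QGL.J N q * ((QGL.lam q)⁻¹ • (QGL.Linv N q - 1))
        + QGL.J N q * QGL.Linv N q * QGL.J N q * QGL.om N q) ∧
    -- nilpotency
    QGL.Qstar N q * QGL.Qstar N q = 0 ∧
    -- commutator with `L`
    (∀ i j, QGL.Qstar N q * QGL.L N q i j - QGL.L N q i j * QGL.Qstar N q = 0) ∧
    -- commutator with `T`
    (∀ i j, QGL.Qstar N q * QGL.T N q i j - QGL.T N q i j * QGL.Qstar N q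
      = -(q ^ (2 * N) • (QGL.T N q * QGL.J N q) i j)) ∧
    -- anticommutator with `J`
    (∀ i j, QGL.Qstar N q * QGL.J N q i j + QGL.J N q i j * QGL.Qstar N q
      = q ^ (2 * N) • (QGL.J N q ^ 2) i j) ∧
    -- anticommutator with `ω`
    (∀ i j, QGL.Qstar N q * QGL.om N q i j + QGL.om N q i j * QGL.Qstar N q
      = q ^ (2 * N) •
          (QGL.W N q * ((QGL.lam q)⁻¹ • (1 - QGL.Linv N q)) * QGL.Wbar N q
            - QGL.lam q • (QGL.om N q * QGL.J N q ^ 2 * QGL.om N q) :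
            Matrix (Fin N) (Fin N) (QGL.DiffAlg N q)) i j) ∧
    -- the graded commutator with `Q*` defines a differential of degree `-1`
    (∃! d : QGL.DiffAlg N q →ₗ[K] QGL.DiffAlg N q,
      (∀ n : ℤ, ∀ a ∈ QGL.homog N q n,
        d a = QGL.Qstar N q * a - ((-1 : K) ^ n) • (a * QGL.Qstar N q)) ∧
      (∀ a, d (d a) = 0) ∧
      (∀ n : ℤ, ∀ a ∈ QGL.homog N q n, ∀ b, d (a * b) = d a * b + ((-1 : K) ^ n) • (a * d b)) ∧
      (∀ n : ℤ, ∀ a ∈ QGL.homog N q n, d a ∈ QGL.homog N q (n - 1))) := by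
  open QGL in
  exact ⟨Qstar_eq_trq hq0 hq1, Qstar_mul_self hq0 hq2,
    commutator_apply_of_scalar (Qstar_commutator_L hq0),
    commutator_apply_of_scalar (Qstar_commutator_T hq0 hq1),
    anticommutator_apply_of_scalar (Qstar_anticommutator_J hq0 hq1),
    anticommutator_apply_of_scalar (Qstar_anticommutator_om hq0 hq1),
    existsUnique_differential odd_neg_one Qstar_mem_homog (Qstar_mul_self hq0 hq2)⟩
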